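/- Let $Z$ be a nonsingular complex $n\times n$ matrix with polar decomposition $Z=U_pH$ ($U_p$ unitary, $H$ Hermitian positive semidefinite). Let $\|\cdot\|$ be any unitarily invariant norm on $\mathbb C^{n\times n}$, that is, a norm with $\|UXV\|=\|X\|$ for all $X$ and all unitary $U,V$. Write $\operatorname{sym}X=\tfrac12(X+X^*)$ and $\operatorname{skw}X=\tfrac12(X-X^*)$. A logarithm of a matrix $A$ is any $X\in\mathbb C^{n\times n}$ with $\exp X=A$; the principal logarithm $\log A$ is the unique logarithm of $A$ all of whose eigenvalues $z$ satisfy $-\pi<\operatorname{Im}z<\pi$. Then $U_p^*Z$ and $H$ each have a unique principal logarithm, and the following hold, where each minimum is over all unitary $Q\in\mathbb C^{n\times n}$ and all $X\in\mathbb C^{n\times n}$ with $\exp X=Q^*Z$, and is attained: $$\min_{Q,\;\exp X=Q^*Z}\|X\|=\|\log(U_p^*Z)\|=\|\log H\|,$$ $$\min_{Q,\;\exp X=Q^*Z}\|\operatorname{sym}X\|=\|\operatorname{sym}\log(U_p^*Z)\|=\|\log H\|,$$ and, for all real $\mu>0$ and $\mu_c\ge 0$, $$\min_{Q,\;\exp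 X=Q^*Z}\bigl(\mu\|\operatorname{sym}X\|+\mu_c\|\operatorname{skw}X\|\bigr)=\mu\|\log H\|.$$ -/

import Mathlib

open scoped Matrix ComplexOrder

namespace PolarLog

/-- A norm on the complex vector space of complex `n × n` matrices with `‖U X V‖ = ‖X‖` for all
unitary `U`, `V`. (Submultiplicativity is not required.) -/
structure IsUnitarilyInvariantNorm {n : ℕ} (N : Matrix (Fin n) (Fin n) ℂ → ℝ) : Prop where
  add_le : ∀ X Y, N (X + Y) ≤ N X + N Y
  smul_eq : ∀ (c : ℂ) (X), N (c • X) = ‖c‖ * N X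
  eq_zero : ∀ X, N X = 0 → X = 0
  unitary_mul_mul : ∀ U ∈ Matrix.unitaryGroup (Fin n) ℂ, ∀ V ∈ Matrix.unitaryGroup (Fin n) ℂ,
    ∀ X, N (U * X * V) = N X

/-- `X` is a logarithm of `A` (one of the possible values of the multivalued `Log A`). -/
def IsLog {n : ℕ} (A X : Matrix (Fin n) (Fin n) ℂ) : Prop :=
  NormedSpace.exp X = A

/-- `Y` is a principal logarithm of `A`: `exp Y = A`, and all eigenvalues of `Y` lie in the open
strip `-π < Im z < π`. Such a `Y` can exist only if `A` has no eigenvalue in `(-∞, 0]`. -/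
def IsPrincipalLog {n : ℕ} (A Y : Matrix (Fin n) (Fin n) ℂ) : Prop :=
  IsLog A Y ∧ ∀ z ∈ spectrum ℂ Y, -Real.pi < z.im ∧ z.im < Real.pi

open Classical in
/-- The principal matrix logarithm `log A`, with the junk value `0` where there is none. -/
noncomputable def log {n : ℕ} (A : Matrix (Fin n) (Fin n) ℂ) : Matrix (Fin n) (Fin n) ℂ :=
  if h : ∃ Y, IsPrincipalLog A Y then h.choose else 0

/-- The Hermitian part. -/
noncomputable def sym {n : ℕ} (X : Matrix (Fin n) (Fin n) ℂ) : Matrix (Fin n) (Fin n) ℂ :=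
  (1 / 2 : ℂ) • (X + Xᴴ)

/-- The skew-Hermitian part. -/
noncomputable def skw {n : ℕ} (X : Matrix (Fin n) (Fin n) ℂ) : Matrix (Fin n) (Fin n) ℂ :=
  (1 / 2 : ℂ) • (X - Xᴴ)

/-- `Z = U H` is a polar decomposition: `U` is unitary and `H` is Hermitian positive
semidefinite. -/
structure IsPolarDecomposition {n : ℕ} (Z U H : Matrix (Fin n) (Fin n) ℂ) : Prop where
  unitary : U ∈ Matrix.unitaryGroup (Fin n) ℂ
  posSemidef : H.PosSemidef
  eq_mul : Z = U * H

/-- The set of all values `f (Log (Q* Z))`, over all unitary `Q` and all logarithms. -/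
def logValues {n : ℕ} (f : Matrix (Fin n) (Fin n) ℂ → ℝ) (Z : Matrix (Fin n) (Fin n) ℂ) : Set ℝ :=
  {r | ∃ Q ∈ Matrix.unitaryGroup (Fin n) ℂ, ∃ X, IsLog (Qᴴ * Z) X ∧ r = f X}

end PolarLog

/-!
Since `Uᴴ Z = H`, the Hermitian logarithm `log H` is an admissible value, equal to its own Hermitian
part. What has to be shown is that `N (log H) ≤ N X` and `N (log H) ≤ N (sym X)` whenever
`exp X = Qᴴ Z`; all that is used of the latter is `(exp X)ᴴ (exp X) = H²`.

Let the orthonormal eigenbasis `v` of `H` flow along `w i t = exp (t X) (v i)`, and let `g i t` be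
the Gram–Schmidt vectors of `w · t` and `u i t` their normalizations. The derivative of `g i` is
`X (g i)` up to the span of the earlier `g j`, to which `g i` is orthogonal. Hence
`(log ‖g i‖)' = Re ⟪u i, X (u i)⟫` (`hasDerivAt_log_norm_gramSchmidt`). At `t = 0` all lengths are
`1`. At `t = 1` the vectors `exp X (v i)` are pairwise orthogonal with the eigenvalues of `H` as
lengths. So the diagonal matrix of the logarithms of the eigenvalues of `H`, which is unitarily
similar to `log H`, is an average of the real parts of the diagonals of `Q(t)ᴴ X Q(t)`, with `Q(t)`
the unitary matrix of columns `u i t`. Passing to the diagonal (an average of conjugations by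
diagonal sign matrices) and to the real part of a diagonal matrix does not increase a unitarily
invariant norm, and the mean value inequality `diagonal_sub_le_of_hasDerivAt` finishes the proof
(`hermLog_le`). The same argument bounds `N (sym X)`, as `X` and `sym X` have the same real
quadratic form. No ordering of eigenvalues or theory of majorization is needed, and no
differentiability of singular values.

For the uniqueness of the principal logarithm, a principal logarithm `Y` of `H` commutes with `H`,
hence with `log H`, so `M = Y - log H` satisfies `exp M = 1` and has eigenvalues in the open strip
`|Im z| < π`, as `log H` has real eigenvalues. Thus `0` is the only eigenvalue of `M`, so `M` is
nilpotent, and a nilpotent logarithm of `1` vanishes.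
-/

/-! ### Pinching and the mean value inequality for unitarily invariant norms -/

namespace PolarLog

namespace IsUnitarilyInvariantNorm

variable {n : ℕ} {N : Matrix (Fin n) (Fin n) ℂ → ℝ}

lemma map_zero (hN : IsUnitarilyInvariantNorm N) : N 0 = 0 := by
  simpa using hN.smul_eq 0 0

lemma nonneg (hN : IsUnitarilyInvariantNorm N) (X : Matrix (Fin n) (Fin n) ℂ) : 0 ≤ N X := by
  have h1 := hN.smul_eq (-1) X
  have h2 := hN.add_le X ((-1 : ℂ) • X)
  have h3 : X + (-1 : ℂ) • X = 0 := by simp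
  rw [h3, hN.map_zero, h1] at h2
  simp only [norm_neg, norm_one, one_mul] at h2
  linarith

lemma smul_eq_of_nonneg (hN : IsUnitarilyInvariantNorm N) {c : ℝ} (hc : 0 ≤ c)
    (X : Matrix (Fin n) (Fin n) ℂ) : N ((c : ℂ) • X) = c * N X := by
  rw [hN.smul_eq, Complex.norm_of_nonneg hc]

lemma half_add_le (hN : IsUnitarilyInvariantNorm N) (X Y : Matrix (Fin n) (Fin n) ℂ) :
    N ((1 / 2 : ℂ) • (X + Y)) ≤ (N X + N Y) / 2 := by
  have h := hN.smul_eq_of_nonneg (c := 1 / 2) (by norm_num) (X + Y)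
  push_cast at h
  rw [h]
  have := hN.add_le X Y
  linarith

end IsUnitarilyInvariantNorm

lemma diagonal_mem_unitaryGroup {n : ℕ} {d : Fin n → ℂ} (hd : ∀ i, star (d i) * d i = 1) :
    Matrix.diagonal d ∈ Matrix.unitaryGroup (Fin n) ℂ := by
  rw [Matrix.mem_unitaryGroup_iff', Matrix.star_eq_conjTranspose, Matrix.diagonal_conjTranspose,
    Matrix.diagonal_mul_diagonal, ← Matrix.diagonal_one]
  congr 1
  funext i
  exact hd i

/-- `M` with the off-diagonal entries in the rows and columns indexed by `s` replaced by `0`. -/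
def pinch {n : ℕ} (s : Finset (Fin n)) (M : Matrix (Fin n) (Fin n) ℂ) :
    Matrix (Fin n) (Fin n) ℂ :=
  fun i j => if i ≠ j ∧ (i ∈ s ∨ j ∈ s) then 0 else M i j

namespace IsUnitarilyInvariantNorm

variable {n : ℕ} {N : Matrix (Fin n) (Fin n) ℂ → ℝ}

/-- Clearing one row and column off the diagonal is averaging with the conjugate by a diagonal
sign matrix. -/
lemma pinch_le (hN : IsUnitarilyInvariantNorm N) (s : Finset (Fin n))
    (M : Matrix (Fin n) (Fin n) ℂ) : N (pinch s M) ≤ N M := by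
  induction s using Finset.induction_on with
  | empty =>
    have : pinch ∅ M = M := by ext i j; simp [pinch]
    rw [this]
  | insert k s hk ih =>
    let d : Fin n → ℂ := fun i => if i = k then -1 else 1
    have hd : Matrix.diagonal d ∈ Matrix.unitaryGroup (Fin n) ℂ :=
      diagonal_mem_unitaryGroup fun i => by by_cases h : i = k <;> simp [d, h]
    have key : pinch (insert k s) M =
        (1 / 2 : ℂ) • (pinch s M + Matrix.diagonal d * pinch s M * Matrix.diagonal d) := by
      ext i j
      simp only [Matrix.smul_apply, Matrix.add_apply, Matrix.mul_diagonal, Matrix.diagonal_mul,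
        pinch, d, Finset.mem_insert, smul_eq_mul]
      by_cases hi : i = k <;> by_cases hj : j = k <;> by_cases hij : i = j <;>
        by_cases his : i ∈ s <;> by_cases hjs : j ∈ s <;> simp_all <;> ring
    rw [key]
    refine (hN.half_add_le _ _).trans ?_
    rw [hN.unitary_mul_mul _ hd _ hd]
    linarith

/-- Pinching to the diagonal does not increase the norm. -/
lemma diagonal_diag_le (hN : IsUnitarilyInvariantNorm N) (M : Matrix (Fin n) (Fin n) ℂ) :
    N (Matrix.diagonal M.diag) ≤ N M := by
  have : Matrix.diagonal M.diag = pinch Finset.univ M := by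
    ext i j
    by_cases h : i = j
    · subst h; simp [pinch]
    · simp [pinch, h]
  rw [this]
  exact hN.pinch_le _ M

lemma diagonal_re_le (hN : IsUnitarilyInvariantNorm N) (d : Fin n → ℂ) :
    N (Matrix.diagonal fun i => ((d i).re : ℂ)) ≤ N (Matrix.diagonal d) := by
  -- The conjugate of a diagonal matrix differs from it by a diagonal unitary factor of phases.
  let u : Fin n → ℂ := fun i => if d i = 0 then 1 else star (d i) / d i
  have hu : Matrix.diagonal u ∈ Matrix.unitaryGroup (Fin n) ℂ :=
    diagonal_mem_unitaryGroup fun i => by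
      by_cases h : d i = 0
      · simp [u, h]
      · simp [u, h]
  have key : (Matrix.diagonal fun i => ((d i).re : ℂ)) =
      (1 / 2 : ℂ) • (Matrix.diagonal d + Matrix.diagonal u * Matrix.diagonal d * 1) := by
    rw [mul_one, Matrix.diagonal_mul_diagonal, Matrix.diagonal_add, ← Matrix.diagonal_smul]
    congr 1
    funext i
    by_cases h : d i = 0
    · simp [u, h]
    · simp [u, h, Complex.re_eq_add_conj]
      ring
  rw [key]
  refine (hN.half_add_le _ _).trans ?_
  rw [hN.unitary_mul_mul _ hu _ (one_mem _)]
  linarith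

lemma diagonal_re_diag_conj_le (hN : IsUnitarilyInvariantNorm N)
    {Q : Matrix (Fin n) (Fin n) ℂ} (hQ : Q ∈ Matrix.unitaryGroup (Fin n) ℂ)
    (Y : Matrix (Fin n) (Fin n) ℂ) :
    N (Matrix.diagonal fun i => (((Qᴴ * Y * Q) i i).re : ℂ)) ≤ N Y := by
  refine (hN.diagonal_re_le fun i => (Qᴴ * Y * Q) i i).trans ?_
  refine (hN.diagonal_diag_le (Qᴴ * Y * Q)).trans ?_
  exact (hN.unitary_mul_mul _ (Unitary.star_mem hQ) _ hQ Y).le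

/-- Mean value inequality for curves of real diagonal matrices, in the norm `N`. -/
lemma diagonal_sub_le_of_hasDerivAt (hN : IsUnitarilyInvariantNorm N) {f f' : ℝ → Fin n → ℝ}
    (hf : ∀ t i, HasDerivAt (fun s => f s i) (f' t i) t) {C : ℝ}
    (hC : ∀ t, N (Matrix.diagonal fun i => (f' t i : ℂ)) ≤ C) :
    N (Matrix.diagonal fun i => ((f 1 i - f 0 i : ℝ) : ℂ)) ≤ C := by
  let p : (Fin n → ℝ) → ℝ := fun x => N (Matrix.diagonal fun i => (x i : ℂ))
  have p_add : ∀ x y, p (x + y) ≤ p x + p y := fun x y => by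
    have : (Matrix.diagonal fun i => ((x + y) i : ℂ)) =
        (Matrix.diagonal fun i => (x i : ℂ)) + Matrix.diagonal fun i => (y i : ℂ) := by
      simp [Matrix.diagonal_add]
    simp only [p, this]
    exact hN.add_le _ _
  have p_smul : ∀ c : ℝ, 0 < c → ∀ x, p (c • x) = c * p x := fun c hc x => by
    have : (Matrix.diagonal fun i => ((c • x) i : ℂ)) =
        (c : ℂ) • Matrix.diagonal fun i => (x i : ℂ) := by
      rw [← Matrix.diagonal_smul]; congr 1; funext i; simp
    simp only [p, this]
    exact hN.smul_eq_of_nonneg hc.le _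
  have p_zero : p 0 = 0 := by simp [p, hN.map_zero]
  -- A linear functional dominated by `N` and norming `f 1 - f 0` reduces to the scalar case.
  obtain ⟨φ, hφ, hφp⟩ : ∃ φ : (Fin n → ℝ) →ₗ[ℝ] ℝ, φ (f 1 - f 0) = p (f 1 - f 0) ∧
      ∀ x, φ x ≤ p x := by
    by_cases h0 : f 1 - f 0 = 0
    · refine ⟨0, by simp [h0, p_zero], fun x => hN.nonneg _⟩
    · obtain ⟨φ, h1, h2⟩ := exists_extension_of_le_sublinear
        (LinearPMap.mkSpanSingleton (K := ℝ) (f 1 - f 0) (p (f 1 - f 0)) h0) p p_smul p_add (by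
          rintro ⟨x, hx⟩
          obtain ⟨c, rfl⟩ := Submodule.mem_span_singleton.1 hx
          rw [LinearPMap.mkSpanSingleton'_apply, RingHom.id_apply, smul_eq_mul]
          rcases le_or_gt c 0 with hc | hc
          · exact (mul_nonpos_of_nonpos_of_nonneg hc (hN.nonneg _)).trans (hN.nonneg _)
          · exact (p_smul c hc _).ge)
      refine ⟨φ, ?_, h2⟩
      rw [h1 ⟨f 1 - f 0, Submodule.mem_span_singleton_self _⟩]
      exact LinearPMap.mkSpanSingleton_apply ℝ ℝ h0 _
  have hd : ∀ t, HasDerivAt (fun s => φ (f s)) (φ (f' t)) t := fun t =>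
    (LinearMap.toContinuousLinearMap φ).hasFDerivAt.comp_hasDerivAt t (hasDerivAt_pi.2 (hf t))
  obtain ⟨ξ, -, hξ⟩ := exists_hasDerivAt_eq_slope (fun s => φ (f s)) (fun t => φ (f' t))
    zero_lt_one (fun t _ => (hd t).continuousAt.continuousWithinAt) fun t _ => hd t
  have h4 : p (f 1 - f 0) = φ (f' ξ) := by
    rw [← hφ, hξ, map_sub]; simp
  calc N (Matrix.diagonal fun i => ((f 1 i - f 0 i : ℝ) : ℂ)) = p (f 1 - f 0) := rfl
    _ = φ (f' ξ) := h4
    _ ≤ p (f' ξ) := hφp _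
    _ ≤ C := hC ξ

end IsUnitarilyInvariantNorm

end PolarLog

/-! ### Gram–Schmidt orthogonalization along a linear flow -/

lemma hasDerivAt_norm_sq_of_complex {E : Type*} [NormedAddCommGroup E] [InnerProductSpace ℂ E]
    {f : ℝ → E} {f' : E} {t : ℝ} (hf : HasDerivAt f f' t) :
    HasDerivAt (fun s => ‖f s‖ ^ 2) (2 * (inner ℂ (f t) f').re) t := by
  let : InnerProductSpace ℝ E := InnerProductSpace.rclikeToReal ℂ E
  exact hf.norm_sq

section GramSchmidtFlow

open InnerProductSpace

variable {ι E : Type*} [LinearOrder ι] [LocallyFiniteOrderBot ι] [WellFoundedLT ι]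
  [NormedAddCommGroup E] [InnerProductSpace ℂ E]

/-- If the vectors `w i` move along the linear flow `w' = A w`, then their Gram–Schmidt
orthogonalization follows the same flow up to the span of the preceding vectors. -/
lemma exists_hasDerivAt_gramSchmidt {w : ℝ → ι → E} {A : E →ₗ[ℂ] E}
    (hw : ∀ i t, HasDerivAt (fun s => w s i) (A (w t i)) t)
    (hli : ∀ t, LinearIndependent ℂ (w t)) (i : ι) (t : ℝ) :
    ∃ d, HasDerivAt (fun s => gramSchmidt ℂ (w s) i) d t ∧
      d - A (gramSchmidt ℂ (w t) i) ∈
        Submodule.span ℂ (gramSchmidt ℂ (w t) '' Set.Iio i) := by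
  induction i using WellFoundedLT.induction with
  | ind i ih =>
    choose! d hd hmem using ih
    have hne : ∀ j, gramSchmidt ℂ (w t) j ≠ 0 := fun j => gramSchmidt_ne_zero j (hli t)
    let α : ℝ → ι → ℂ := fun s j =>
      inner ℂ (gramSchmidt ℂ (w s) j) (w s i) / ((‖gramSchmidt ℂ (w s) j‖ ^ 2 : ℝ) : ℂ)
    have hα : ∀ j < i, ∃ c, HasDerivAt (fun s => α s j) c t := by
      intro j hj
      have h1 := (hd j hj).inner ℂ (hw i t)
      have h2 := (hasDerivAt_norm_sq_of_complex (hd j hj)).ofReal_comp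
      exact ⟨_, h1.div h2 (by simpa using hne j)⟩
    choose! c hc using hα
    have hgs : ∀ s, gramSchmidt ℂ (w s) i =
        w s i - ∑ j ∈ Finset.Iio i, α s j • gramSchmidt ℂ (w s) j := by
      intro s
      rw [eq_sub_iff_add_eq]
      conv_rhs => rw [gramSchmidt_def'' ℂ (w s) i]
      simp [α]
    have hder : HasDerivAt (fun s => gramSchmidt ℂ (w s) i)
        (A (w t i) - ∑ j ∈ Finset.Iio i,
          (α t j • d j + c j • gramSchmidt ℂ (w t) j)) t := by
      have h3 : HasDerivAt (fun s => ∑ j ∈ Finset.Iio i, α s j • gramSchmidt ℂ (w s) j)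
          (∑ j ∈ Finset.Iio i, (α t j • d j + c j • gramSchmidt ℂ (w t) j)) t :=
        HasDerivAt.fun_sum fun j hj =>
          (hc j (Finset.mem_Iio.1 hj)).smul (hd j (Finset.mem_Iio.1 hj))
      exact ((hw i t).sub h3).congr_of_eventuallyEq (.of_forall hgs)
    refine ⟨_, hder, ?_⟩
    have h4 : A (w t i) - ∑ j ∈ Finset.Iio i, (α t j • d j + c j • gramSchmidt ℂ (w t) j) -
        A (gramSchmidt ℂ (w t) i) = -∑ j ∈ Finset.Iio i,
          (α t j • (d j - A (gramSchmidt ℂ (w t) j)) + c j • gramSchmidt ℂ (w t) j) := by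
      rw [hgs t]
      simp only [map_sub, map_sum, map_smul, smul_sub, Finset.sum_add_distrib,
        Finset.sum_sub_distrib]
      abel
    rw [h4]
    refine neg_mem (sum_mem fun j hj => ?_)
    have hj' : j < i := Finset.mem_Iio.1 hj
    refine add_mem (Submodule.smul_mem _ _ ?_)
      (Submodule.smul_mem _ _ (Submodule.subset_span ⟨j, hj', rfl⟩))
    exact Submodule.span_mono (Set.image_mono (Set.Iio_subset_Iio hj'.le)) (hmem j hj')

/-- Along a linear flow `w' = A w`, the logarithmic derivative of the length of the `i`-th
Gram–Schmidt vector is the real part of the `i`-th diagonal entry of `A` in the Gram–Schmidt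
orthonormal system. -/
lemma hasDerivAt_log_norm_gramSchmidt {w : ℝ → ι → E} {A : E →ₗ[ℂ] E}
    (hw : ∀ i t, HasDerivAt (fun s => w s i) (A (w t i)) t)
    (hli : ∀ t, LinearIndependent ℂ (w t)) (i : ι) (t : ℝ) :
    HasDerivAt (fun s => Real.log ‖gramSchmidt ℂ (w s) i‖)
      (inner ℂ (gramSchmidtNormed ℂ (w t) i) (A (gramSchmidtNormed ℂ (w t) i))).re t := by
  obtain ⟨d, hd, hmem⟩ := exists_hasDerivAt_gramSchmidt hw hli i t
  set g := gramSchmidt ℂ (w t) i with hg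
  have hne : g ≠ 0 := gramSchmidt_ne_zero i (hli t)
  have hne' : ‖g‖ ≠ 0 := norm_ne_zero_iff.2 hne
  have horth : inner ℂ g (d - A g) = 0 := by
    refine Submodule.span_induction (p := fun x _ => inner ℂ g x = 0) ?_ ?_ ?_ ?_ hmem
    · rintro _ ⟨j, hj, rfl⟩
      exact gramSchmidt_orthogonal ℂ (w t) (ne_of_gt hj)
    · simp
    · intro x y _ _ hx hy; simp [hx, hy]
    · intro a x _ hx; simp [hx]
  have hgd : inner ℂ g d = inner ℂ g (A g) := by
    rwa [inner_sub_right, sub_eq_zero] at horth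
  have h1 : HasDerivAt (fun s => ‖gramSchmidt ℂ (w s) i‖ ^ 2) (2 * (inner ℂ g d).re) t :=
    hasDerivAt_norm_sq_of_complex hd
  have h2 := (h1.log (by rw [← hg]; positivity)).const_mul (1 / 2 : ℝ)
  refine (h2.congr_of_eventuallyEq (.of_forall fun s => ?_)).congr_deriv ?_
  · simp only [Real.log_pow]; push_cast; ring
  · rw [hgd, ← hg, gramSchmidtNormed, ← hg, map_smul, inner_smul_left, inner_smul_right,
      ← mul_assoc, map_inv₀, RCLike.conj_ofReal, ← mul_inv]
    have h3 : (((‖g‖ : ℂ) * (‖g‖ : ℂ))⁻¹ * inner ℂ g (A g)).re =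
        (‖g‖ * ‖g‖)⁻¹ * (inner ℂ g (A g)).re := by
      rw [← Complex.ofReal_mul, ← Complex.ofReal_inv, Complex.re_ofReal_mul]
    refine Eq.trans ?_ h3.symm
    field_simp

end GramSchmidtFlow

/-! ### Logarithms of the identity -/

section ExpEqOne

/-- If `M ^ (k + 2) = 0`, then `exp M = 1` gives `M ^ k = exp M * M ^ k = M ^ k + M ^ (k + 1)`;
descending on the exponent leaves only `M = 0`. -/
lemma eq_zero_of_isNilpotent_of_exp_eq_one {A : Type*} [NormedRing A] [NormedAlgebra ℂ A]
    [CompleteSpace A] {M : A} (hM : IsNilpotent M) (h : NormedSpace.exp M = 1) : M = 0 := by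
  have step : ∀ k, M ^ (k + 2) = 0 → M ^ (k + 1) = 0 := by
    intro k hk
    have h1 := (NormedSpace.exp_series_hasSum_exp' (𝕂 := ℂ) M).mul_left (M ^ k)
    have h2 : HasSum (fun j : ℕ => M ^ k * (((j.factorial : ℂ))⁻¹ • M ^ j))
        (∑ j ∈ Finset.range 2, M ^ k * (((j.factorial : ℂ))⁻¹ • M ^ j)) := by
      refine hasSum_sum_of_ne_finset_zero fun j hj => ?_
      obtain ⟨l, rfl⟩ := Nat.exists_eq_add_of_le (not_lt.1 (Finset.mem_range.not.1 hj))
      rw [mul_smul_comm, ← pow_add, ← add_assoc, pow_add, hk, zero_mul, smul_zero]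
    have h3 := h1.unique h2
    rw [h, Finset.sum_range_succ, Finset.sum_range_one] at h3
    simpa [← pow_succ] using h3
  obtain ⟨k, hk⟩ := hM
  have : ∀ k, M ^ (k + 1) = 0 → M = 0 := by
    intro k
    induction k with
    | zero => simp
    | succ k ih => exact fun h => ih (step k h)
  exact this k (by rw [pow_succ, hk, zero_mul])

variable {n : ℕ}

lemma Matrix.isNilpotent_of_spectrum_subset_zero {M : Matrix (Fin n) (Fin n) ℂ}
    (hM : ∀ z ∈ spectrum ℂ M, z = 0) : IsNilpotent M := by
  have hs : M.charpoly.Splits := IsAlgClosed.splits _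
  have h1 := hs.eq_prod_roots_of_monic M.charpoly_monic
  have h2 : M.charpoly.roots = Multiset.replicate (Multiset.card M.charpoly.roots) 0 :=
    Multiset.eq_replicate_card.2 fun z hz =>
      hM z (Matrix.mem_spectrum_of_isRoot_charpoly (Polynomial.isRoot_of_mem_roots hz))
  rw [h2] at h1
  have h3 := M.aeval_self_charpoly
  rw [h1] at h3
  exact ⟨_, by simpa using h3⟩

/-- Commuting matrices have a common eigenvector for each eigenvalue of the first. -/
lemma Matrix.exists_common_eigenvector {M D : Matrix (Fin n) (Fin n) ℂ} (h : Commute M D) {z : ℂ}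
    (hz : z ∈ spectrum ℂ M) :
    ∃ (d : ℂ) (v : Fin n → ℂ), v ≠ 0 ∧ M *ᵥ v = z • v ∧ D *ᵥ v = d • v := by
  have hc : Commute (Matrix.toLin' M) (Matrix.toLin' D) := by
    have := congrArg Matrix.toLin' h.eq
    rwa [Matrix.toLin'_mul, Matrix.toLin'_mul] at this
  rw [← Matrix.spectrum_toLin', ← Module.End.hasEigenvalue_iff_mem_spectrum] at hz
  have hmap := Module.End.mapsTo_genEigenspace_of_comm hc z 1
  let p := Module.End.eigenspace (Matrix.toLin' M) z
  have : Nontrivial p := Submodule.nontrivial_iff_ne_bot.2 hz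
  obtain ⟨d, hd⟩ := Module.End.exists_eigenvalue ((Matrix.toLin' D).restrict (p := p) (q := p) hmap)
  obtain ⟨⟨v, hvp⟩, hv⟩ := hd.exists_hasEigenvector
  refine ⟨d, v, fun h0 => hv.2 (Subtype.ext h0), ?_, ?_⟩
  · simpa using Module.End.mem_eigenspace_iff.1 hvp
  · exact congrArg Subtype.val hv.apply_eq_smul

lemma Matrix.mem_spectrum_of_mulVec_eq {M : Matrix (Fin n) (Fin n) ℂ} {z : ℂ} {v : Fin n → ℂ}
    (hv : v ≠ 0) (h : M *ᵥ v = z • v) : z ∈ spectrum ℂ M := by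
  rw [← Matrix.spectrum_toLin', ← Module.End.hasEigenvalue_iff_mem_spectrum]
  exact Module.End.hasEigenvalue_of_hasEigenvector
    ⟨Module.End.mem_eigenspace_iff.2 (by simpa using h), hv⟩

/-- The only principal logarithm of `1` is `0`. -/
lemma Matrix.eq_zero_of_exp_eq_one {M : Matrix (Fin n) (Fin n) ℂ} (h : NormedSpace.exp M = 1)
    (hM : ∀ z ∈ spectrum ℂ M, -Real.pi < z.im ∧ z.im < Real.pi) : M = 0 := by
  let : NormedRing (Matrix (Fin n) (Fin n) ℂ) := Matrix.linftyOpNormedRing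
  let : NormedAlgebra ℂ (Matrix (Fin n) (Fin n) ℂ) := Matrix.linftyOpNormedAlgebra
  refine eq_zero_of_isNilpotent_of_exp_eq_one
    (Matrix.isNilpotent_of_spectrum_subset_zero fun z hz => ?_) h
  obtain ⟨h1, h2⟩ := hM z hz
  have h3 : Complex.exp z ∈ spectrum ℂ (1 : Matrix (Fin n) (Fin n) ℂ) := by
    have := spectrum.exp_mem_exp M hz
    rw [← Complex.exp_eq_exp_ℂ] at this
    exact h ▸ this
  have : Nontrivial (Matrix (Fin n) (Fin n) ℂ) := by
    by_contra hn
    rw [not_nontrivial_iff_subsingleton] at hn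
    simp at hz
  rw [spectrum.one_eq, Set.mem_singleton_iff, ← Complex.exp_zero] at h3
  exact Complex.exp_inj_of_neg_pi_lt_of_le_pi h1 h2.le (by simpa using Real.pi_pos)
    (by simpa using Real.pi_pos.le) h3

end ExpEqOne

/-! ### Matrix flows in Euclidean space -/

section MatrixFlow

variable {n : ℕ}

lemma hasDerivAt_toEuclideanLin_exp_smul (X : Matrix (Fin n) (Fin n) ℂ)
    (v : EuclideanSpace ℂ (Fin n)) (t : ℝ) :
    HasDerivAt (fun s : ℝ => Matrix.toEuclideanLin (NormedSpace.exp (s • X)) v)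
      (Matrix.toEuclideanLin X (Matrix.toEuclideanLin (NormedSpace.exp (t • X)) v)) t := by
  let : NormedRing (Matrix (Fin n) (Fin n) ℂ) := Matrix.linftyOpNormedRing
  let : NormedAlgebra ℝ (Matrix (Fin n) (Fin n) ℂ) := Matrix.linftyOpNormedAlgebra
  have h1 : HasDerivAt (fun s : ℝ => NormedSpace.exp (s • X)) (X * NormedSpace.exp (t • X)) t :=
    hasDerivAt_exp_smul_const' X t
  let Φ : Matrix (Fin n) (Fin n) ℂ →ₗ[ℝ] EuclideanSpace ℂ (Fin n) :=
    { toFun := fun M => Matrix.toEuclideanLin M v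
      map_add' := fun M N => by simp
      map_smul' := fun c M => by
        change Matrix.toEuclideanLin (c • M) v = c • Matrix.toEuclideanLin M v
        ext i
        simp [Matrix.toLpLin_apply, Matrix.smul_mulVec] }
  have h2 := (LinearMap.toContinuousLinearMap Φ).hasFDerivAt.comp_hasDerivAt t h1
  refine h2.congr_deriv ?_
  change Matrix.toEuclideanLin (X * NormedSpace.exp (t • X)) v = _
  simp [Matrix.toLpLin_apply, Matrix.mulVec_mulVec]

lemma linearIndependent_toEuclideanLin_of_isUnit {ι : Type*} {M : Matrix (Fin n) (Fin n) ℂ}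
    (hM : IsUnit M) {v : ι → EuclideanSpace ℂ (Fin n)} (hv : LinearIndependent ℂ v) :
    LinearIndependent ℂ fun i => Matrix.toEuclideanLin M (v i) := by
  refine hv.map' (Matrix.toEuclideanLin M) (LinearMap.ker_eq_bot.2 ?_)
  intro x y hxy
  have h := congrArg WithLp.ofLp hxy
  simp only [Matrix.toLpLin_apply] at h
  exact WithLp.ofLp_injective 2 (Matrix.mulVec_injective_of_isUnit hM h)

lemma inner_toEuclideanLin_toEuclideanLin (M : Matrix (Fin n) (Fin n) ℂ)
    (x y : EuclideanSpace ℂ (Fin n)) :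
    inner ℂ (Matrix.toEuclideanLin M x) (Matrix.toEuclideanLin M y) =
      inner ℂ x (Matrix.toEuclideanLin (Mᴴ * M) y) := by
  have h := LinearMap.adjoint_inner_right (Matrix.toEuclideanLin M) x (Matrix.toEuclideanLin M y)
  rw [← h, ← Matrix.toEuclideanLin_conjTranspose_eq_adjoint]
  congr 1
  simp [Matrix.toLpLin_apply, Matrix.mulVec_mulVec]

/-- The matrix whose columns are the vectors `u i`. -/
def matrixOfColumns (u : Fin n → EuclideanSpace ℂ (Fin n)) : Matrix (Fin n) (Fin n) ℂ :=
  Matrix.of fun i j => u j i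

lemma matrixOfColumns_conj_apply (u : Fin n → EuclideanSpace ℂ (Fin n))
    (Y : Matrix (Fin n) (Fin n) ℂ) (i j : Fin n) :
    ((matrixOfColumns u)ᴴ * Y * matrixOfColumns u) i j =
      inner ℂ (u i) (Matrix.toEuclideanLin Y (u j)) := by
  rw [Matrix.mul_assoc, EuclideanSpace.inner_eq_star_dotProduct, Matrix.mul_apply, dotProduct]
  refine Finset.sum_congr rfl fun k _ => ?_
  simp [matrixOfColumns, Matrix.mul_apply, Matrix.toLpLin_apply, Matrix.mulVec, dotProduct,
    mul_comm]

lemma matrixOfColumns_mem_unitaryGroup {u : Fin n → EuclideanSpace ℂ (Fin n)}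
    (hu : Orthonormal ℂ u) : matrixOfColumns u ∈ Matrix.unitaryGroup (Fin n) ℂ := by
  rw [Matrix.mem_unitaryGroup_iff', Matrix.star_eq_conjTranspose]
  ext i j
  have h := matrixOfColumns_conj_apply u 1 i j
  rw [Matrix.mul_one] at h
  rw [h, Matrix.one_apply]
  simpa [Matrix.toLpLin_apply] using orthonormal_iff_ite.1 hu i j

end MatrixFlow

namespace PolarLog

open InnerProductSpace

variable {n : ℕ}

/-! ### The Hermitian logarithm and its minimality -/

/-- The Hermitian logarithm of a Hermitian matrix, obtained from its spectral decomposition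
(with `Real.log` applied to the eigenvalues, so it is meaningful for positive definite matrices). -/
noncomputable def hermLog {H : Matrix (Fin n) (Fin n) ℂ} (hH : H.IsHermitian) :
    Matrix (Fin n) (Fin n) ℂ :=
  (hH.eigenvectorUnitary : Matrix (Fin n) (Fin n) ℂ) *
    Matrix.diagonal (fun i => (Real.log (hH.eigenvalues i) : ℂ)) *
    (hH.eigenvectorUnitary : Matrix (Fin n) (Fin n) ℂ)ᴴ

/-- The Hermitian logarithm of a positive definite `H` has norm at most that of any `Y` for
which `Re ⟪u, Y u⟫ = Re ⟪u, X u⟫` for all `u`, for some `X` with `(exp X)ᴴ (exp X) = H²`. -/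
lemma IsUnitarilyInvariantNorm.hermLog_le {N : Matrix (Fin n) (Fin n) ℂ → ℝ}
    (hN : IsUnitarilyInvariantNorm N) {H : Matrix (Fin n) (Fin n) ℂ} (hH : H.PosDef)
    {X Y : Matrix (Fin n) (Fin n) ℂ} (hX : (NormedSpace.exp X)ᴴ * NormedSpace.exp X = H * H)
    (hY : ∀ u : EuclideanSpace ℂ (Fin n), (inner ℂ u (Matrix.toEuclideanLin X u)).re =
      (inner ℂ u (Matrix.toEuclideanLin Y u)).re) :
    N (hermLog hH.isHermitian) ≤ N Y := by
  have hV := hH.isHermitian.eigenvectorUnitary.2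
  rw [hermLog, ← Matrix.star_eq_conjTranspose, hN.unitary_mul_mul _ hV _ (Unitary.star_mem hV)]
  let v := hH.isHermitian.eigenvectorBasis
  let w : ℝ → Fin n → EuclideanSpace ℂ (Fin n) := fun t j =>
    Matrix.toEuclideanLin (NormedSpace.exp (t • X)) (v j)
  have hw : ∀ j t, HasDerivAt (fun s => w s j) (Matrix.toEuclideanLin X (w t j)) t :=
    fun j t => hasDerivAt_toEuclideanLin_exp_smul X (v j) t
  have hli : ∀ t, LinearIndependent ℂ (w t) := fun t =>
    linearIndependent_toEuclideanLin_of_isUnit (Matrix.isUnit_exp _)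
      v.orthonormal.linearIndependent
  -- Pinching, in the Gram–Schmidt basis at time `t`, bounds the logarithmic derivatives by `N Y`.
  have hbound := hN.diagonal_sub_le_of_hasDerivAt (C := N Y)
    (f := fun t i => Real.log ‖gramSchmidt ℂ (w t) i‖)
    (fun t i => hasDerivAt_log_norm_gramSchmidt hw hli i t) (fun t => by
      have hQ := matrixOfColumns_mem_unitaryGroup (gramSchmidtNormed_orthonormal (hli t))
      refine le_trans (le_of_eq ?_) (hN.diagonal_re_diag_conj_le hQ Y)
      congr 2
      funext i
      rw [matrixOfColumns_conj_apply, hY])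
  -- At `t = 0` the flow starts at the eigenbasis of `H`; at `t = 1` its vectors are orthogonal, with
  -- the eigenvalues of `H` as lengths, so Gram–Schmidt changes nothing at either end.
  refine le_trans (le_of_eq ?_) hbound
  congr 2
  funext i
  have hHv : ∀ j, Matrix.toEuclideanLin H (v j) =
      (hH.isHermitian.eigenvalues j : ℂ) • v j := fun j => by
    ext k
    simpa [Matrix.toLpLin_apply] using congrFun (hH.isHermitian.mulVec_eigenvectorBasis j) k
  have h0 : gramSchmidt ℂ (w 0) i = v i := by
    have : w 0 = v := by
      funext j
      simp [w, Matrix.toLpLin_apply, NormedSpace.exp_zero]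
    rw [this, gramSchmidt_of_orthogonal ℂ fun a b hab => v.orthonormal.2 hab]
  have hinner : ∀ a b, inner ℂ (w 1 a) (w 1 b) =
      ((hH.isHermitian.eigenvalues b : ℂ) * hH.isHermitian.eigenvalues b) *
        inner ℂ (v a) (v b) := fun a b => by
    have h2 : Matrix.toEuclideanLin (H * H) (v b) =
        ((hH.isHermitian.eigenvalues b : ℂ) * hH.isHermitian.eigenvalues b) • v b := by
      have : Matrix.toEuclideanLin (H * H) (v b) =
          Matrix.toEuclideanLin H (Matrix.toEuclideanLin H (v b)) := by
        simp [Matrix.toLpLin_apply, Matrix.mulVec_mulVec]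
      rw [this, hHv, map_smul, hHv, smul_smul]
    simp only [w, one_smul]
    rw [inner_toEuclideanLin_toEuclideanLin, hX, h2, inner_smul_right]
  have h1 : ‖gramSchmidt ℂ (w 1) i‖ = hH.isHermitian.eigenvalues i := by
    rw [gramSchmidt_of_orthogonal ℂ fun a b hab => by
      simpa [v.orthonormal.2 hab] using hinner a b]
    have h3 := hinner i i
    rw [inner_self_eq_norm_sq_to_K, inner_self_eq_norm_sq_to_K, v.orthonormal.1 i] at h3
    have h4 : ‖w 1 i‖ ^ 2 = hH.isHermitian.eigenvalues i ^ 2 := by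
      rw [pow_two (hH.isHermitian.eigenvalues i)]
      exact_mod_cast (by simpa using h3 :
        ((‖w 1 i‖ : ℂ)) ^ 2 = (hH.isHermitian.eigenvalues i : ℂ) * hH.isHermitian.eigenvalues i)
    exact (pow_left_inj₀ (norm_nonneg _) (hH.eigenvalues_pos i).le two_ne_zero).1 h4
  rw [h0, h1, v.orthonormal.1 i, Real.log_one, sub_zero]

/-! ### Existence and uniqueness of the principal logarithm -/

lemma conjTranspose_hermLog {H : Matrix (Fin n) (Fin n) ℂ} (hH : H.IsHermitian) :
    (hermLog hH)ᴴ = hermLog hH := by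
  simp only [hermLog, Matrix.conjTranspose_mul, Matrix.conjTranspose_conjTranspose,
    Matrix.diagonal_conjTranspose, Matrix.mul_assoc]
  congr 3
  funext i
  simp

lemma unitary_conj_eq_iff {V A B : Matrix (Fin n) (Fin n) ℂ}
    (hV : V ∈ Matrix.unitaryGroup (Fin n) ℂ) : A = V * B * Vᴴ ↔ Vᴴ * A * V = B := by
  have h1 : Vᴴ * V = 1 := Matrix.mem_unitaryGroup_iff'.1 hV
  have h2 : V * Vᴴ = 1 := Matrix.mem_unitaryGroup_iff.1 hV
  constructor
  · rintro rfl
    calc Vᴴ * (V * B * Vᴴ) * V = (Vᴴ * V) * B * (Vᴴ * V) := by simp only [Matrix.mul_assoc]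
      _ = B := by rw [h1, one_mul, mul_one]
  · rintro rfl
    calc A = (V * Vᴴ) * A * (V * Vᴴ) := by rw [h2, one_mul, mul_one]
      _ = _ := by simp only [Matrix.mul_assoc]

lemma exp_unitary_conj {V : Matrix (Fin n) (Fin n) ℂ} (hV : V ∈ Matrix.unitaryGroup (Fin n) ℂ)
    (A : Matrix (Fin n) (Fin n) ℂ) :
    NormedSpace.exp (V * A * Vᴴ) = V * NormedSpace.exp A * Vᴴ := by
  have h2 : V * Vᴴ = 1 := Matrix.mem_unitaryGroup_iff.1 hV
  rw [← Matrix.inv_eq_right_inv h2]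
  exact Matrix.exp_conj V A ⟨⟨V, Vᴴ, h2, Matrix.mem_unitaryGroup_iff'.1 hV⟩, rfl⟩

lemma eq_conj_diagonal_eigenvalues {H : Matrix (Fin n) (Fin n) ℂ} (hH : H.IsHermitian) :
    H = (hH.eigenvectorUnitary : Matrix (Fin n) (Fin n) ℂ) *
      Matrix.diagonal (fun i => (hH.eigenvalues i : ℂ)) *
      (hH.eigenvectorUnitary : Matrix (Fin n) (Fin n) ℂ)ᴴ := by
  conv_lhs => rw [hH.spectral_theorem, Unitary.conjStarAlgAut_apply]
  rfl

lemma exp_hermLog {H : Matrix (Fin n) (Fin n) ℂ} (hH : H.PosDef) :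
    NormedSpace.exp (hermLog hH.isHermitian) = H := by
  rw [hermLog, exp_unitary_conj hH.isHermitian.eigenvectorUnitary.2, Matrix.exp_diagonal]
  conv_rhs => rw [eq_conj_diagonal_eigenvalues hH.isHermitian]
  congr 3
  funext i
  rw [Pi.coe_exp, ← Complex.exp_eq_exp_ℂ, ← Complex.ofReal_exp,
    Real.exp_log (hH.eigenvalues_pos i)]

lemma im_eq_zero_of_mem_spectrum_hermLog {H : Matrix (Fin n) (Fin n) ℂ} (hH : H.IsHermitian)
    {z : ℂ} (hz : z ∈ spectrum ℂ (hermLog hH)) : z.im = 0 := by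
  have h : (hermLog hH).IsHermitian := conjTranspose_hermLog hH
  rw [h.spectrum_eq_image_range] at hz
  obtain ⟨x, -, rfl⟩ := hz
  exact Complex.ofReal_im x

lemma commute_hermLog {H Y : Matrix (Fin n) (Fin n) ℂ} (hH : H.PosDef) (hY : Commute Y H) :
    Commute Y (hermLog hH.isHermitian) := by
  set V := (hH.isHermitian.eigenvectorUnitary : Matrix (Fin n) (Fin n) ℂ) with hVdef
  have hV : V ∈ Matrix.unitaryGroup (Fin n) ℂ := hH.isHermitian.eigenvectorUnitary.2
  have h1 : Vᴴ * V = 1 := Matrix.mem_unitaryGroup_iff'.1 hV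
  obtain ⟨B, hB⟩ : ∃ B, Y = V * B * Vᴴ := ⟨_, (unitary_conj_eq_iff hV).2 rfl⟩
  have hmul : ∀ A C, (V * A * Vᴴ) * (V * C * Vᴴ) = V * (A * C) * Vᴴ := fun A C => by
    calc (V * A * Vᴴ) * (V * C * Vᴴ) = V * A * (Vᴴ * V) * C * Vᴴ := by
          simp only [Matrix.mul_assoc]
      _ = _ := by rw [h1, mul_one, Matrix.mul_assoc V]
  have h2 : B * Matrix.diagonal (fun i => (hH.isHermitian.eigenvalues i : ℂ)) =
      Matrix.diagonal (fun i => (hH.isHermitian.eigenvalues i : ℂ)) * B := by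
    have h3 := hY.eq
    rw [eq_conj_diagonal_eigenvalues hH.isHermitian, ← hVdef, hB, hmul, hmul,
      unitary_conj_eq_iff hV] at h3
    exact (h3.symm.trans ((unitary_conj_eq_iff hV).1 rfl)).symm
  rw [Commute, SemiconjBy, hermLog, ← hVdef, hB, hmul, hmul]
  congr 2
  ext i j
  have h4 := congrFun (congrFun h2 i) j
  rw [Matrix.mul_diagonal, Matrix.diagonal_mul] at h4 ⊢
  -- `B` has no entries between different eigenvalues of `H`, and equal ones have equal logarithms.
  by_cases h5 : hH.isHermitian.eigenvalues i = hH.isHermitian.eigenvalues j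
  · rw [h5, mul_comm]
  · have h6 : B i j = 0 := by
      have : B i j * ((hH.isHermitian.eigenvalues j : ℂ) - hH.isHermitian.eigenvalues i) = 0 := by
        rw [mul_sub, h4]; ring
      rcases mul_eq_zero.1 this with h | h
      · exact h
      · exact absurd (by exact_mod_cast (sub_eq_zero.1 h).symm) h5
    rw [h6, zero_mul, mul_zero]

lemma isPrincipalLog_hermLog {H : Matrix (Fin n) (Fin n) ℂ} (hH : H.PosDef) :
    IsPrincipalLog H (hermLog hH.isHermitian) := by
  refine ⟨exp_hermLog hH, fun z hz => ?_⟩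
  rw [im_eq_zero_of_mem_spectrum_hermLog hH.isHermitian hz]
  exact ⟨neg_neg_of_pos Real.pi_pos, Real.pi_pos⟩

/-- A principal logarithm `Y` of `H` commutes with the Hermitian logarithm, so their difference
is a logarithm of `1` whose eigenvalues have the imaginary parts of eigenvalues of `Y`. -/
lemma IsPrincipalLog.eq_hermLog {H Y : Matrix (Fin n) (Fin n) ℂ} (hH : H.PosDef)
    (hY : IsPrincipalLog H Y) : Y = hermLog hH.isHermitian := by
  have hexp : NormedSpace.exp Y = H := hY.1
  have hc : Commute Y (hermLog hH.isHermitian) := by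
    refine commute_hermLog hH ?_
    rw [← hexp]
    exact (Commute.refl Y).exp_right
  rw [← sub_eq_zero]
  refine Matrix.eq_zero_of_exp_eq_one ?_ fun z hz => ?_
  · have hu : IsUnit H := hexp ▸ Matrix.isUnit_exp Y
    rw [sub_eq_add_neg, Matrix.exp_add_of_commute _ _ hc.neg_right, Matrix.exp_neg, hexp,
      exp_hermLog hH, Matrix.mul_nonsing_inv _ ((Matrix.isUnit_iff_isUnit_det H).1 hu)]
  · obtain ⟨d, v, hv, h1, h2⟩ := Matrix.exists_common_eigenvector
      (hc.sub_left (Commute.refl (hermLog hH.isHermitian))) hz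
    have hd := im_eq_zero_of_mem_spectrum_hermLog hH.isHermitian
      (Matrix.mem_spectrum_of_mulVec_eq hv h2)
    have h3 : Y *ᵥ v = (z + d) • v := by
      rw [add_smul, ← h1, ← h2, Matrix.sub_mulVec, sub_add_cancel]
    simpa [hd] using hY.2 _ (Matrix.mem_spectrum_of_mulVec_eq hv h3)

lemma existsUnique_isPrincipalLog {H : Matrix (Fin n) (Fin n) ℂ} (hH : H.PosDef) :
    ∃! L, IsPrincipalLog H L :=
  ⟨_, isPrincipalLog_hermLog hH, fun _ hY => hY.eq_hermLog hH⟩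

lemma log_eq_hermLog {H : Matrix (Fin n) (Fin n) ℂ} (hH : H.PosDef) :
    log H = hermLog hH.isHermitian := by
  have h : ∃ Y, IsPrincipalLog H Y := ⟨_, isPrincipalLog_hermLog hH⟩
  rw [log, dif_pos h]
  exact h.choose_spec.eq_hermLog hH

/-! ### Hermitian and skew-Hermitian parts -/

lemma sym_eq_self {X : Matrix (Fin n) (Fin n) ℂ} (h : Xᴴ = X) : sym X = X := by
  rw [sym, h, ← two_smul ℂ X, smul_smul]; norm_num

lemma skw_eq_zero {X : Matrix (Fin n) (Fin n) ℂ} (h : Xᴴ = X) : skw X = 0 := by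
  rw [skw, h, sub_self, smul_zero]

lemma re_inner_sym (X : Matrix (Fin n) (Fin n) ℂ) (u : EuclideanSpace ℂ (Fin n)) :
    (inner ℂ u (Matrix.toEuclideanLin X u)).re =
      (inner ℂ u (Matrix.toEuclideanLin (sym X) u)).re := by
  have h : inner ℂ u (Matrix.toEuclideanLin Xᴴ u) =
      (starRingEnd ℂ) (inner ℂ u (Matrix.toEuclideanLin X u)) := by
    rw [Matrix.toEuclideanLin_conjTranspose_eq_adjoint, LinearMap.adjoint_inner_right,
      inner_conj_symm]
  rw [sym, map_smul, map_add, LinearMap.smul_apply, LinearMap.add_apply, inner_smul_right,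
    inner_add_right, h, Complex.add_conj]
  have h2 : (1 / 2 : ℂ) = ((1 / 2 : ℝ) : ℂ) := by norm_num
  rw [h2, ← Complex.ofReal_mul, Complex.ofReal_re]
  ring

end PolarLog

theorem theorem3p1 (n : ℕ) (Z U H : Matrix (Fin n) (Fin n) ℂ) (hZ : IsUnit Z)
    (hUH : PolarLog.IsPolarDecomposition Z U H)
    (N : Matrix (Fin n) (Fin n) ℂ → ℝ) (hN : PolarLog.IsUnitarilyInvariantNorm N) :
    -- the principal logarithms of `U* Z` and of `H` exist and are unique
    ((∃! L, PolarLog.IsPrincipalLog (Uᴴ * Z) L) ∧ (∃! L, PolarLog.IsPrincipalLog H L)) ∧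
    (IsLeast (PolarLog.logValues N Z) (N (PolarLog.log (Uᴴ * Z))) ∧
      N (PolarLog.log (Uᴴ * Z)) = N (PolarLog.log H)) ∧
    (IsLeast (PolarLog.logValues (fun X => N (PolarLog.sym X)) Z)
        (N (PolarLog.sym (PolarLog.log (Uᴴ * Z)))) ∧
      N (PolarLog.sym (PolarLog.log (Uᴴ * Z))) = N (PolarLog.log H)) ∧
    (∀ μ μc : ℝ, 0 < μ → 0 ≤ μc →
      IsLeast (PolarLog.logValues
          (fun X => μ * N (PolarLog.sym X) + μc * N (PolarLog.skw X)) Z)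
        (μ * N (PolarLog.log H))) := by
  obtain ⟨hU, hpsd, rfl⟩ := hUH
  have hUU : Uᴴ * U = 1 := Matrix.mem_unitaryGroup_iff'.1 hU
  have hUZ : Uᴴ * (U * H) = H := by rw [← Matrix.mul_assoc, hUU, one_mul]
  have hHu : IsUnit H := by
    rw [← hUZ]
    have hUu : IsUnit Uᴴ := ⟨⟨Uᴴ, U, hUU, Matrix.mem_unitaryGroup_iff.1 hU⟩, rfl⟩
    exact hUu.mul hZ
  have hH : H.PosDef := hpsd.posDef_iff_isUnit.2 hHu
  have hsa := PolarLog.conjTranspose_hermLog hH.isHermitian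
  have hlog : PolarLog.IsLog (Uᴴ * (U * H)) (PolarLog.hermLog hH.isHermitian) := by
    rw [hUZ]; exact PolarLog.exp_hermLog hH
  have hsq : ∀ Q ∈ Matrix.unitaryGroup (Fin n) ℂ, ∀ X, PolarLog.IsLog (Qᴴ * (U * H)) X →
      (NormedSpace.exp X)ᴴ * NormedSpace.exp X = H * H := by
    intro Q hQ X hX
    have hX' : NormedSpace.exp X = Qᴴ * (U * H) := hX
    have hQQ : Q * Qᴴ = 1 := Matrix.mem_unitaryGroup_iff.1 hQ
    rw [hX', Matrix.conjTranspose_mul, Matrix.conjTranspose_mul, Matrix.conjTranspose_conjTranspose,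
      hH.isHermitian.eq]
    calc H * Uᴴ * Q * (Qᴴ * (U * H)) = H * (Uᴴ * ((Q * Qᴴ) * (U * H))) := by
          simp only [Matrix.mul_assoc]
      _ = H * H := by rw [hQQ, one_mul, hUZ]
  have hle : ∀ Q ∈ Matrix.unitaryGroup (Fin n) ℂ, ∀ X, PolarLog.IsLog (Qᴴ * (U * H)) X →
      N (PolarLog.hermLog hH.isHermitian) ≤ N X := fun Q hQ X hX =>
    hN.hermLog_le hH (hsq Q hQ X hX) fun _ => rfl
  have hle_sym : ∀ Q ∈ Matrix.unitaryGroup (Fin n) ℂ, ∀ X, PolarLog.IsLog (Qᴴ * (U * H)) X →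
      N (PolarLog.hermLog hH.isHermitian) ≤ N (PolarLog.sym X) := fun Q hQ X hX =>
    hN.hermLog_le hH (hsq Q hQ X hX) (PolarLog.re_inner_sym X)
  simp only [hUZ, PolarLog.log_eq_hermLog hH, PolarLog.sym_eq_self hsa]
  refine ⟨⟨PolarLog.existsUnique_isPrincipalLog hH, PolarLog.existsUnique_isPrincipalLog hH⟩,
    ⟨⟨⟨U, hU, _, hlog, rfl⟩, ?_⟩, trivial⟩,
    ⟨⟨⟨U, hU, _, hlog, by simp only [PolarLog.sym_eq_self hsa]⟩, ?_⟩, trivial⟩,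
    fun μ μc hμ hμc => ⟨⟨U, hU, _, hlog, ?_⟩, ?_⟩⟩
  · rintro _ ⟨Q, hQ, X, hX, rfl⟩
    exact hle Q hQ X hX
  · rintro _ ⟨Q, hQ, X, hX, rfl⟩
    exact hle_sym Q hQ X hX
  · simp only [PolarLog.sym_eq_self hsa, PolarLog.skw_eq_zero hsa, hN.map_zero, mul_zero, add_zero]
  · rintro _ ⟨Q, hQ, X, hX, rfl⟩
    have h1 := mul_le_mul_of_nonneg_left (hle_sym Q hQ X hX) hμ.le
    have h2 := mul_nonneg hμc (hN.nonneg (PolarLog.skw X))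
    linarith
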